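/- Let $d\ge 0$ be an integer, $T\ge 0$, and let $\mathcal T=C([0,T];\mathbb R^d)$ carry the uniform topology and its Borel $\sigma$-algebra. For $0\le u\le v\le T$ let $\mathcal F_{u,v}$ be the $\sigma$-algebra generated by the restriction of paths to $[u,v]$. For probability measures $\mu,\nu$ on a measurable space and a sub-$\sigma$-algebra $\mathcal H$, put $$R_{\mathcal H}(\mu\|\nu)=\sup_f\Big\{E^\mu[f]-\log E^\nu[e^f]\Big\}\in[0,\infty],$$ the supremum being over all bounded $\mathcal H$-measurable $f$; $\mathcal H$ is omitted when it is the full $\sigma$-algebra, and $R_0(\mu\|P)$ denotes $R_{\mathcal H}(\mu\|P)$ with $\mathcal H$ generated by $x\mapsto x_0$. Let $P$ be a probability measure on $\mathcal T$ under which the coordinate process is a (possibly time-inhomogeneous) Markov process (for instance the law of a Markov–Feller diffusion), and let $\mu$ be any probability measure on $\mathcal T$. For $s\in[0,T]$ let $P_{|s,z}$ be the regular conditional law, on $C([s,T];\mathbb R^d)$, of $(X_r)_{r\in[s,T]}$ under $P$ given $X_s=z$ (any versions that are probability kernels in $z\in\mathbb R^d$). Let $\mu_{|[0,s],x}$ be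 the regular conditional law of $(X_r)_{r\in[s,T]}$ under $\mu$ given $X_r=x_r$ for all $r\in[0,s]$, and, for a finite set $\sigma\subset[0,s]$, let $\mu_{|\sigma,y}$ be that law given $X_r=y_r$ for all $r\in\sigma$. A subscript $t$, as in $P_{t|s,z}$, $\mu_{t|[0,s],x}$, $\mu_{t|\sigma,y}$, denotes the law of $X_t$ under these measures ($t\ge s$). Write $\mu_{[0,s]}$ and $\mu_\sigma$ for the laws of $(X_r)_{r\in[0,s]}$ and $(X_r)_{r\in\sigma}$ under $\mu$. Let $\mathbf J_*$ be the set of all finite sets $\sigma=\{0=t_1<t_2<\dots<t_{m}=T\}$, $m=m(\sigma)$, and put $\sigma_{;j}=\{t_1,\dots,t_j\}$. Then, as identities in $[0,\infty]$: 1. For every $\sigma\in\mathbf J_*$, $$R(\mu\|P)=R_0(\mu\|P)+\sum_{j=1}^{m(\sigma)-1}E^{\mu_{[0,t_j]}(x)}\Big[R_{\mathcal F_{t_j,t_{j+1}}}\big(\mu_{|[0,t_j],x}\,\big\|\,P_{|t_j,x_{t_j}}\big)\Big].$$ 2. $$R(\mu\|P)=R_0(\mu\|P)+\sup_{\sigma\in\mathbf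 J_*}\sum_{j=1}^{m(\sigma)-1}E^{\mu_{\sigma_{;j}}(y)}\Big[R\big(\mu_{t_{j+1}|\sigma_{;j},y}\,\big\|\,P_{t_{j+1}|t_j,y_{t_j}}\big)\Big].$$ 3. For all $0\le s<t\le T$, $$E^{\mu_{[0,s]}(x)}\Big[R\big(\mu_{t|[0,s],x}\,\big\|\,P_{t|s,x_s}\big)\Big]=\sup_{\sigma}E^{\mu_\sigma(y)}\Big[R\big(\mu_{t|\sigma,y}\,\big\|\,P_{t|s,y_s}\big)\Big],$$ the supremum being over all finite sets $\sigma\subset[0,s]$ with $s\in\sigma$. -/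

import Mathlib

open MeasureTheory ProbabilityTheory Set
open scoped ENNReal

noncomputable section

/-! ### Relative entropy -/

/-- Relative entropy `R_H(μ || ν)` of the probability measures `μ`, `ν` over the sub-σ-algebra `H`:
the supremum of `E^μ[f] - log E^ν[exp f]` over all bounded `H`-measurable functions `f`.
The value for `f = 0` is `0`, so the supremum is nonnegative and cutting the single terms off at `0`
does not change it. -/
def relEntropyOn {Ω : Type*} (H : MeasurableSpace Ω) [MeasurableSpace Ω] (μ ν : Measure Ω) : ℝ≥0∞ :=
  ⨆ (f : Ω → ℝ) (_ : Measurable[H] f) (_ : ∃ C : ℝ, ∀ ω, |f ω| ≤ C),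
    ENNReal.ofReal ((∫ ω, f ω ∂μ) - Real.log (∫ ω, Real.exp (f ω) ∂ν))

/-- Relative entropy `R(μ || ν)` over the full σ-algebra of the space. -/
def relEntropy {Ω : Type*} [mΩ : MeasurableSpace Ω] (μ ν : Measure Ω) : ℝ≥0∞ :=
  relEntropyOn mΩ μ ν

/-! ### Path spaces -/

/-- The space `C([s,t]; ℝ^d)` with the topology of uniform convergence. -/
abbrev PathSpace (d : ℕ) (s t : ℝ) : Type := C(Icc s t, EuclideanSpace ℝ (Fin d))

/-- Path spaces carry their Borel σ-algebra. -/
instance PathSpace.measurableSpace (d : ℕ) (s t : ℝ) : MeasurableSpace (PathSpace d s t) := borel _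

instance PathSpace.borelSpace (d : ℕ) (s t : ℝ) : BorelSpace (PathSpace d s t) := ⟨rfl⟩

/-- Restriction of a path on `[s,t]` to a subinterval `[u,v]`. -/
def restrictPath {d : ℕ} {s t u v : ℝ} (h : Icc u v ⊆ Icc s t) (x : PathSpace d s t) : PathSpace d u v :=
  x.comp ⟨Set.inclusion h, continuous_inclusion h⟩

/-- The σ-algebra `𝓕_{u,v}` on `C([s,t]; ℝ^d)` generated by the restriction to `[u,v]`. -/
@[reducible] def windowSigma (d : ℕ) {s t u v : ℝ} (h : Icc u v ⊆ Icc s t) : MeasurableSpace (PathSpace d s t) :=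
  MeasurableSpace.comap (restrictPath h) inferInstance

/-- The σ-algebra on `C([s,t]; ℝ^d)` generated by the evaluation at time `r`. -/
@[reducible] def timeSigma (d : ℕ) {s t : ℝ} (r : Icc s t) : MeasurableSpace (PathSpace d s t) :=
  MeasurableSpace.comap (fun x : PathSpace d s t => x r) inferInstance

/-- The restriction of a path on `[0,T]` to `[0,s]`. -/
def pastPath {d : ℕ} {T : ℝ} (s : Icc (0 : ℝ) T) (x : PathSpace d 0 T) : PathSpace d 0 s :=
  restrictPath (Icc_subset_Icc le_rfl s.2.2) x

/-- The restriction of a path on `[0,T]` to `[s,T]`. -/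
def futurePath {d : ℕ} {T : ℝ} (s : Icc (0 : ℝ) T) (x : PathSpace d 0 T) : PathSpace d s T :=
  restrictPath (Icc_subset_Icc s.2.1 le_rfl) x

/-- The projection `π_σ(x) = (x_{t_1}, …, x_{t_m})` for a finite family of times `σ`. -/
def skeleton {d m : ℕ} {T : ℝ} (σ : Fin m → Icc (0 : ℝ) T) (x : PathSpace d 0 T) :
    Fin m → EuclideanSpace ℝ (Fin d) :=
  fun i => x (σ i)

/-- The law at time `t` of a measure on `C([s,T]; ℝ^d)`, for `s ≤ t ≤ T`. -/
def lawAt {d : ℕ} {T : ℝ} {s t : Icc (0 : ℝ) T} (hst : s ≤ t) (ν : Measure (PathSpace d s T)) :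
    Measure (EuclideanSpace ℝ (Fin d)) :=
  ν.map (fun w => w ⟨t, hst, t.2.2⟩)

/-! ### Partitions -/

/-- `σ` enumerates increasingly a finite set of times with first element `0` and last element `T`. -/
structure IsFullPartition {T : ℝ} {n : ℕ} (σ : Fin (n + 1) → Icc (0 : ℝ) T) : Prop where
  strictMono : StrictMono σ
  first : (σ 0 : ℝ) = 0
  last : (σ (Fin.last n) : ℝ) = T

/-- `σ_{;j}`, the initial segment of a partition that ends with the element of index `j`. -/
def initialSegment {T : ℝ} {n : ℕ} (σ : Fin (n + 1) → Icc (0 : ℝ) T) (j : Fin n) :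
    Fin (j + 1) → Icc (0 : ℝ) T :=
  fun i => σ (Fin.castLE (by omega) i)

/-! ### Regular conditional probabilities -/

instance PathSpace.polishSpace (d : ℕ) (s t : ℝ) : PolishSpace (PathSpace d s t) := inferInstance

instance PathSpace.nonempty (d : ℕ) (s t : ℝ) : Nonempty (PathSpace d s t) := ⟨ContinuousMap.const _ 0⟩

/-- `μ_{|[0,s],x}`: the regular conditional law on `C([s,T]; ℝ^d)` of the path after time `s`,
given the path `x` on `[0,s]`. -/
def rcpPast {d : ℕ} {T : ℝ} (μ : Measure (PathSpace d 0 T)) [IsFiniteMeasure μ] (s : Icc (0 : ℝ) T) :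
    Kernel (PathSpace d 0 s) (PathSpace d s T) :=
  condDistrib (futurePath s) (pastPath s) μ

/-- `μ_{|σ,y}`: the regular conditional law on `C([s,T]; ℝ^d)` of the path after time `s`,
given the values `y` at the times of `σ`. -/
def rcpSkeleton {d m : ℕ} {T : ℝ} (μ : Measure (PathSpace d 0 T)) [IsFiniteMeasure μ]
    (σ : Fin m → Icc (0 : ℝ) T) (s : Icc (0 : ℝ) T) :
    Kernel (Fin m → EuclideanSpace ℝ (Fin d)) (PathSpace d s T) :=
  condDistrib (futurePath s) (skeleton σ) μ

/-- `κ` is a version of the regular conditional laws `z ↦ P_{|s,z}` on `C([s,T]; ℝ^d)` of the path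
after time `s`, given that its value at time `s` is `z`, for all `s`. -/
structure IsStateRcp {d : ℕ} {T : ℝ} (P : Measure (PathSpace d 0 T))
    (κ : ∀ s : Icc (0 : ℝ) T, Kernel (EuclideanSpace ℝ (Fin d)) (PathSpace d s T)) : Prop where
  isMarkovKernel : ∀ s, IsMarkovKernel (κ s)
  hasCondDistrib : ∀ s, HasCondDistrib (futurePath s) (fun x => x s) (κ s) P

/-- Under `P` the coordinate process is a Markov process: for every `s ∈ [0,T]` and every event `A`
of the future `𝓕_{s,T}`, the conditional probabilities of `A` given the past `𝓕_{0,s}` and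
given the value at time `s` agree almost surely. -/
def IsMarkovLaw {d : ℕ} {T : ℝ} (P : Measure (PathSpace d 0 T)) : Prop :=
  ∀ (s : Icc (0 : ℝ) T) (A : Set (PathSpace d 0 T)),
    MeasurableSet[windowSigma d (Icc_subset_Icc (s.2.1 : (0 : ℝ) ≤ s) (le_refl T))] A →
      P⟦A | windowSigma d (Icc_subset_Icc (le_refl (0 : ℝ)) (s.2.2 : (s : ℝ) ≤ T))⟧
        =ᵐ[P] P⟦A | timeSigma d s⟧

end

/-! By the Donsker-Varadhan formula (`relEntropy_eq_klDiv`, `relEntropyOn_comap`), the relative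
entropy over the σ-algebra generated by a map is the Kullback-Leibler divergence of the image laws.
Everything then rests on two properties of divergences: the chain rule for a pair of variables
(`klDiv_map_prodMk`), and exhaustion by a generating filtration (`relEntropy_le_iSup_relEntropyOn`),
whose converse inequality is data processing.

The Markov property turns `κ`, evaluated at the present state, into a conditional law of `P` given
the whole past, or given finitely many times ending at the present. The chain rule for a path cut at
`s` therefore produces exactly the window terms of the first identity, which telescope. For
skeletons it produces the one-step terms of the second; evaluations at a dense set of times generate
the Borel σ-algebra, so refining partitions recover the full entropy.

In the third identity, the left side is the divergence between two joint laws of (past, state at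
`t`) that share the marginal of the past; replacing the past by a skeleton gives the terms on the
right. -/

open InformationTheory Filter Topology

/-! ### The variational formula for the Kullback-Leibler divergence -/

section Variational

variable {Ω : Type*} {mΩ : MeasurableSpace Ω}

/-- Young's inequality for the conjugate pair `klFun` and `exp - 1`. -/
lemma mul_le_klFun_add_exp_sub_one {g : ℝ} (hg : 0 ≤ g) (y : ℝ) :
    g * y ≤ klFun g + (Real.exp y - 1) := by
  rw [klFun_apply]
  rcases hg.eq_or_lt with rfl | hg
  · simp [(Real.exp_pos y).le]
  · have h := Real.add_one_le_exp (y - Real.log g)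
    rw [Real.exp_sub, Real.exp_log hg, le_div_iff₀ hg] at h
    linarith

lemma integrable_exp_of_abs_le {ν : Measure Ω} [IsFiniteMeasure ν] {f : Ω → ℝ} (hf : Measurable f)
    {C : ℝ} (hC : ∀ ω, |f ω| ≤ C) : Integrable (fun ω ↦ Real.exp (f ω)) ν :=
  Integrable.of_bound (by fun_prop) (Real.exp C) <| .of_forall fun ω ↦ by
    rw [Real.norm_eq_abs, Real.abs_exp]
    exact Real.exp_le_exp.2 ((le_abs_self _).trans (hC ω))

lemma integrable_of_abs_le {ν : Measure Ω} [IsFiniteMeasure ν] {f : Ω → ℝ} (hf : Measurable f)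
    {C : ℝ} (hC : ∀ ω, |f ω| ≤ C) : Integrable f ν :=
  Integrable.of_bound (by fun_prop) C <| .of_forall hC

lemma integral_exp_pos_of_abs_le {ν : Measure Ω} [IsProbabilityMeasure ν] {f : Ω → ℝ}
    (hf : Measurable f) {C : ℝ} (hC : ∀ ω, |f ω| ≤ C) : 0 < ∫ ω, Real.exp (f ω) ∂ν :=
  integral_exp_pos (integrable_exp_of_abs_le hf hC)

/-- Subtracting `c = log ∫ exp f dν` normalises `exp (f - c)` to integral one; Young's inequality
with `g = dμ/dν` and `y = f - c` is then integrated against `ν`. -/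
lemma integral_sub_log_integral_exp_le_klDiv (μ ν : Measure Ω) [IsProbabilityMeasure μ]
    [IsProbabilityMeasure ν] {f : Ω → ℝ} (hf : Measurable f) {C : ℝ} (hC : ∀ ω, |f ω| ≤ C) :
    ENNReal.ofReal ((∫ ω, f ω ∂μ) - Real.log (∫ ω, Real.exp (f ω) ∂ν)) ≤ klDiv μ ν := by
  by_cases h : klDiv μ ν = ∞
  · simp [h]
  obtain ⟨hac, hint⟩ := klDiv_ne_top_iff.1 h
  rw [← ENNReal.ofReal_toReal h, toReal_klDiv_eq_integral_klFun hac]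
  apply ENNReal.ofReal_le_ofReal
  set c := Real.log (∫ ω, Real.exp (f ω) ∂ν)
  have hpos := integral_exp_pos_of_abs_le (ν := ν) hf hC
  have hfi : Integrable f μ := integrable_of_abs_le hf hC
  have hkl : Integrable (fun ω ↦ klFun (μ.rnDeriv ν ω).toReal) ν :=
    (integrable_klFun_rnDeriv_iff hac).2 hint
  have hexp : Integrable (fun ω ↦ Real.exp (f ω - c)) ν := by
    simp_rw [Real.exp_sub]
    exact (integrable_exp_of_abs_le hf hC).div_const _
  have hexp1 : ∫ ω, Real.exp (f ω - c) ∂ν = 1 := by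
    simp_rw [Real.exp_sub]
    rw [integral_div, Real.exp_log hpos, div_self hpos.ne']
  have hexp2 : Integrable (fun ω ↦ Real.exp (f ω - c) - 1) ν := hexp.sub (integrable_const 1)
  have hfc : Integrable (fun ω ↦ f ω - c) μ := hfi.sub (integrable_const c)
  have hg : Integrable (fun ω ↦ (μ.rnDeriv ν ω).toReal * (f ω - c)) ν := by
    simpa [smul_eq_mul] using (integrable_rnDeriv_smul_iff hac).2 hfc
  calc (∫ ω, f ω ∂μ) - c = ∫ ω, (f ω - c) ∂μ := by
        rw [integral_sub hfi (integrable_const c)]; simp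
    _ = ∫ ω, (μ.rnDeriv ν ω).toReal * (f ω - c) ∂ν := by
        simpa [smul_eq_mul] using (integral_rnDeriv_smul hac (f := fun ω ↦ f ω - c)).symm
    _ ≤ ∫ ω, (klFun (μ.rnDeriv ν ω).toReal + (Real.exp (f ω - c) - 1)) ∂ν :=
        integral_mono hg (hkl.add hexp2)
          fun ω ↦ mul_le_klFun_add_exp_sub_one ENNReal.toReal_nonneg _
    _ = _ := by
        rw [integral_add hkl hexp2, integral_sub hexp (integrable_const 1), hexp1]
        simp

/-- The truncation at level `n` of the logarithm. -/
noncomputable def truncLog (n : ℕ) (x : ℝ) : ℝ :=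
  Real.log (max (Real.exp (-n)) (min x (Real.exp n)))

lemma measurable_truncLog (n : ℕ) : Measurable (truncLog n) := by
  unfold truncLog; fun_prop

lemma abs_truncLog_le (n : ℕ) (x : ℝ) : |truncLog n x| ≤ n := by
  have hn : Real.exp (-n : ℝ) ≤ Real.exp n := Real.exp_le_exp.2 (by linarith [n.cast_nonneg (α := ℝ)])
  have hpos : 0 < max (Real.exp (-n)) (min x (Real.exp n)) :=
    lt_max_of_lt_left (Real.exp_pos _)
  rw [abs_le, truncLog]
  constructor
  · rw [Real.le_log_iff_exp_le hpos]; exact le_max_left _ _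
  · rw [Real.log_le_iff_le_exp hpos]; exact max_le hn (min_le_right _ _)

lemma exp_truncLog (n : ℕ) (x : ℝ) :
    Real.exp (truncLog n x) = max (Real.exp (-n)) (min x (Real.exp n)) :=
  Real.exp_log (lt_max_of_lt_left (Real.exp_pos _))

/-- Between the cut-offs this is `klFun x`. Below, it is at least `1 - (n + 1) * exp (-n)`, above,
at least `(n - 1) * exp n + 1`. Nonnegativity lets the integrals in Fatou's lemma be computed as
Bochner integrals. -/
lemma mul_truncLog_add_one_sub_exp_nonneg {n : ℕ} (hn : 1 ≤ n) {x : ℝ} (hx : 0 ≤ x) :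
    0 ≤ x * truncLog n x + 1 - Real.exp (truncLog n x) := by
  have hn' : (1 : ℝ) ≤ n := by exact_mod_cast hn
  have hle : Real.exp (-n : ℝ) ≤ Real.exp n := Real.exp_le_exp.2 (by linarith)
  have h1 := exp_truncLog n x
  rcases le_total x (Real.exp (-n)) with h | h
  · rw [min_eq_left (h.trans hle), max_eq_left h, Real.exp_eq_exp] at h1
    rw [h1]
    have h2 := Real.add_one_le_exp (n : ℝ)
    have h3 : Real.exp (-n : ℝ) * Real.exp n = 1 := by rw [← Real.exp_add]; simp
    have h4 := Real.exp_pos (-n : ℝ)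
    nlinarith
  rcases le_total x (Real.exp n) with h' | h'
  · rw [min_eq_left h', max_eq_right h] at h1
    have : truncLog n x = Real.log x := by conv_rhs => rw [← h1, Real.log_exp]
    rw [this, Real.exp_log ((Real.exp_pos _).trans_le h)]
    exact klFun_nonneg hx
  · rw [min_eq_right h', max_eq_right hle, Real.exp_eq_exp] at h1
    rw [h1]
    nlinarith

lemma tendsto_truncLog {x : ℝ} (hx : 0 ≤ x) :
    Tendsto (fun n : ℕ ↦ x * truncLog n x + 1 - Real.exp (truncLog n x)) atTop (𝓝 (klFun x)) := by
  have he : Tendsto (fun n : ℕ ↦ Real.exp (-n : ℝ)) atTop (𝓝 0) :=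
    Real.tendsto_exp_neg_atTop_nhds_zero.comp tendsto_natCast_atTop_atTop
  have hE : Tendsto (fun n : ℕ ↦ Real.exp (n : ℝ)) atTop atTop :=
    Real.tendsto_exp_atTop.comp tendsto_natCast_atTop_atTop
  have hm : Tendsto (fun n : ℕ ↦ max (Real.exp (-n : ℝ)) (min x (Real.exp n))) atTop (𝓝 x) := by
    have : Tendsto (fun n : ℕ ↦ min x (Real.exp n)) atTop (𝓝 x) :=
      tendsto_const_nhds.congr' <| by
        filter_upwards [hE.eventually_ge_atTop x] with n hn using (min_eq_left hn).symm
    simpa [hx] using he.max this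
  -- The logarithm has no limit at `0`, but there the factor `x` removes it.
  rcases hx.eq_or_lt with rfl | hx
  · simp only [exp_truncLog, zero_mul, zero_add, klFun_zero]
    simpa using hm.const_sub 1
  · have := ((hm.log hx.ne').const_mul x).add_const 1
    simp only [exp_truncLog, klFun_apply]
    exact this.sub hm

/-- The **Donsker-Varadhan variational formula**. -/
theorem relEntropy_eq_klDiv (μ ν : Measure Ω) [IsProbabilityMeasure μ] [IsProbabilityMeasure ν] :
    relEntropy μ ν = klDiv μ ν := by
  apply le_antisymm
  · exact iSup_le fun f ↦ iSup_le fun hf ↦ iSup_le fun ⟨C, hC⟩ ↦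
      integral_sub_log_integral_exp_le_klDiv μ ν hf hC
  -- `log z ≤ z - 1` makes the bound linear in `exp f`, so that for `μ ≪ ν` it becomes one integral
  -- against `ν`. The ideal test function `log (dμ/dν)` is approached by truncations and Fatou's
  -- lemma.
  have hlb {f : Ω → ℝ} (hf : Measurable f) {C : ℝ} (hC : ∀ ω, |f ω| ≤ C) :
      ENNReal.ofReal ((∫ ω, f ω ∂μ) + 1 - ∫ ω, Real.exp (f ω) ∂ν) ≤ relEntropy μ ν := by
    refine le_trans (ENNReal.ofReal_le_ofReal ?_)
      (le_iSup_of_le f <| le_iSup_of_le hf <| le_iSup_of_le ⟨C, hC⟩ le_rfl)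
    linarith [Real.log_le_sub_one_of_pos (integral_exp_pos_of_abs_le (ν := ν) hf hC)]
  by_cases hac : μ ≪ ν
  · rw [klDiv_eq_lintegral_klFun_of_ac hac]
    set g : Ω → ℝ := fun ω ↦ (μ.rnDeriv ν ω).toReal
    have hg : Measurable g := by fun_prop
    calc ∫⁻ ω, ENNReal.ofReal (klFun (g ω)) ∂ν
      = ∫⁻ ω, liminf (fun n : ℕ ↦ ENNReal.ofReal
          (g ω * truncLog n (g ω) + 1 - Real.exp (truncLog n (g ω)))) atTop ∂ν := by
          refine lintegral_congr fun ω ↦ ?_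
          exact ((ENNReal.tendsto_ofReal
            (tendsto_truncLog (x := g ω) ENNReal.toReal_nonneg)).liminf_eq).symm
      _ ≤ liminf (fun n : ℕ ↦ ∫⁻ ω, ENNReal.ofReal
          (g ω * truncLog n (g ω) + 1 - Real.exp (truncLog n (g ω))) ∂ν) atTop := by
          refine lintegral_liminf_le fun n ↦ ?_
          have := (measurable_truncLog n).comp hg
          simp only [Function.comp_def] at this
          fun_prop
      _ ≤ relEntropy μ ν := by
          refine (liminf_le_liminf (v := fun _ : ℕ ↦ relEntropy μ ν) ?_).trans_eq (liminf_const _)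
          filter_upwards [eventually_ge_atTop 1] with n hn
          have hm := (measurable_truncLog n).comp hg
          have hb : ∀ ω, |(truncLog n ∘ g) ω| ≤ n := fun ω ↦ abs_truncLog_le n _
          refine le_of_eq_of_le ?_ (hlb hm hb)
          have hexp : Integrable (fun ω ↦ Real.exp (truncLog n (g ω))) ν :=
            integrable_exp_of_abs_le hm hb
          have hgi : Integrable (fun ω ↦ g ω * truncLog n (g ω)) ν := by
            simpa [smul_eq_mul] using
              (integrable_rnDeriv_smul_iff hac).2 (integrable_of_abs_le hm hb)
          have hgi1 : Integrable (fun ω ↦ g ω * truncLog n (g ω) + 1) ν :=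
            hgi.add (integrable_const 1)
          have hsub : Integrable
              (fun ω ↦ g ω * truncLog n (g ω) + 1 - Real.exp (truncLog n (g ω))) ν := hgi1.sub hexp
          rw [← ofReal_integral_eq_lintegral_ofReal hsub (.of_forall fun ω ↦
              mul_truncLog_add_one_sub_exp_nonneg hn ENNReal.toReal_nonneg),
            integral_sub hgi1 hexp, integral_add hgi (integrable_const 1)]
          have : ∫ ω, g ω * truncLog n (g ω) ∂ν = ∫ ω, truncLog n (g ω) ∂μ := by
            simpa [smul_eq_mul] using integral_rnDeriv_smul hac (f := fun ω ↦ truncLog n (g ω))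
          simp [this]
  -- Multiples `n · 1_A` of the indicator of a set with `ν A = 0 < μ A` give arbitrarily large
  -- values.
  · rw [klDiv_of_not_ac hac]
    obtain ⟨A, hA, hνA, hμA⟩ : ∃ A, MeasurableSet A ∧ ν A = 0 ∧ μ A ≠ 0 := by
      by_contra! h
      exact hac (.mk h)
    have hpos : 0 < μ.real A := ENNReal.toReal_pos hμA (measure_ne_top _ _)
    have hlim : Tendsto (fun n : ℕ ↦ ENNReal.ofReal (μ.real A * n)) atTop (𝓝 ∞) :=
      ENNReal.tendsto_ofReal_atTop.comp (tendsto_natCast_atTop_atTop.const_mul_atTop hpos)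
    refine le_of_tendsto' hlim fun n ↦ ?_
    have hm : Measurable (A.indicator fun _ ↦ (n : ℝ)) := measurable_const.indicator hA
    have hb : ∀ ω, |A.indicator (fun _ ↦ (n : ℝ)) ω| ≤ n := fun ω ↦ by
      by_cases h : ω ∈ A <;> simp [h]
    refine le_of_eq_of_le ?_ (hlb hm hb)
    have h0 : ∫ ω, Real.exp (A.indicator (fun _ ↦ (n : ℝ)) ω) ∂ν = 1 := by
      rw [integral_congr_ae (g := fun _ ↦ 1)]
      · simp
      · filter_upwards [measure_eq_zero_iff_ae_notMem.1 hνA] with ω hω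
        simp [hω]
    rw [h0, integral_indicator_const _ hA]
    simp [smul_eq_mul]

end Variational

/-! ### Relative entropy over generated σ-algebras, and invariance under re-encoding -/

section SubSigmaAlgebra

variable {Ω E : Type*} {mΩ : MeasurableSpace Ω} {mE : MeasurableSpace E}

/-- The relative entropy over the σ-algebra generated by a map is that of the image laws. -/
theorem relEntropyOn_comap (μ ν : Measure Ω) [IsProbabilityMeasure μ] [IsProbabilityMeasure ν]
    {π : Ω → E} (hπ : Measurable π) :
    relEntropyOn (mE.comap π) μ ν = klDiv (μ.map π) (ν.map π) := by
  have := Measure.isProbabilityMeasure_map (μ := μ) hπ.aemeasurable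
  have := Measure.isProbabilityMeasure_map (μ := ν) hπ.aemeasurable
  rw [← relEntropy_eq_klDiv]
  have hint (ρ : Measure Ω) {g : E → ℝ} (hg : Measurable g) :
      ∫ y, g y ∂(ρ.map π) = ∫ ω, g (π ω) ∂ρ :=
    integral_map hπ.aemeasurable hg.aestronglyMeasurable
  apply le_antisymm
  · refine iSup_le fun f ↦ iSup_le fun hf ↦ iSup_le fun ⟨C, hC⟩ ↦ ?_
    obtain ⟨h, hh, rfl⟩ := (Measurable.stronglyMeasurable hf).exists_eq_measurable_comp
    -- The factor `h` is bounded only on the range of `π`; clamping bounds it everywhere without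
    -- changing `h ∘ π`.
    have hm : Measurable fun y ↦ max (-C) (min (h y) C) := by
      have := hh.measurable
      fun_prop
    have hclamp (ω : Ω) : max (-C) (min (h (π ω)) C) = h (π ω) := by
      have := abs_le.1 (hC ω)
      simp only [Function.comp_apply] at this
      rw [min_eq_left this.2, max_eq_right this.1]
    refine le_of_eq_of_le ?_ (le_iSup_of_le (fun y ↦ max (-C) (min (h y) C)) <|
      le_iSup_of_le hm <| le_iSup_of_le ⟨|C|, fun y ↦ ?_⟩ le_rfl)
    · rw [hint μ hm, hint ν hm.exp]
      simp_rw [hclamp]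
      rfl
    · rw [abs_le]
      constructor
      · exact (neg_le_neg (le_abs_self C)).trans (le_max_left _ _)
      · exact max_le (neg_le_abs C) ((min_le_right _ _).trans (le_abs_self C))
  · refine iSup_le fun f ↦ iSup_le fun hf ↦ iSup_le fun ⟨C, hC⟩ ↦ ?_
    rw [hint μ hf, hint ν hf.exp]
    exact le_iSup_of_le (f ∘ π) <| le_iSup_of_le (hf.comp (comap_measurable π)) <|
      le_iSup_of_le ⟨C, fun ω ↦ hC _⟩ le_rfl

/-- Relative entropy over a generating filtration exhausts the relative entropy. -/
theorem relEntropy_le_iSup_relEntropyOn (μ ν : Measure Ω) [IsProbabilityMeasure μ]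
    [IsProbabilityMeasure ν] (ℱ : Filtration ℕ mΩ) (hℱ : mΩ ≤ ⨆ n, ℱ n) :
    relEntropy μ ν ≤ ⨆ n, relEntropyOn (ℱ n) μ ν := by
  refine iSup_le fun f ↦ iSup_le fun hf ↦ iSup_le fun ⟨C, hC⟩ ↦ ?_
  -- Lévy's upward theorem under `μ + ν` gives one approximating sequence that converges almost
  -- everywhere for both measures.
  let ρ : Measure Ω := μ + ν
  have hconv : ∀ᵐ ω ∂ρ, Tendsto (fun n ↦ (ρ[f | ℱ n]) ω) atTop (𝓝 (f ω)) :=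
    (integrable_of_abs_le hf hC).tendsto_ae_condExp (hf.mono hℱ le_rfl).stronglyMeasurable
  -- Test functions must be bounded pointwise, not just almost everywhere.
  let g (n : ℕ) (ω : Ω) : ℝ := max (-C) (min ((ρ[f | ℱ n]) ω) C)
  have hgF (n : ℕ) : Measurable[ℱ n] (g n) :=
    measurable_const.max ((stronglyMeasurable_condExp.measurable).min measurable_const)
  have hgm (n : ℕ) : Measurable (g n) := (hgF n).mono (ℱ.le n) le_rfl
  have hgb (n : ℕ) (ω : Ω) : |g n ω| ≤ C := by
    have hC0 : 0 ≤ C := (abs_nonneg _).trans (hC ω)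
    exact abs_le.2 ⟨le_max_left _ _, max_le (by linarith) (min_le_right _ _)⟩
  have hglim : ∀ᵐ ω ∂ρ, Tendsto (fun n ↦ g n ω) atTop (𝓝 (f ω)) := by
    filter_upwards [hconv] with ω hω
    have h := abs_le.1 (hC ω)
    simpa [h.1, h.2] using
      tendsto_const_nhds (x := -C) |>.max (hω.min (tendsto_const_nhds (x := C)))
  obtain ⟨hμlim, hνlim⟩ := ae_add_measure_iff.1 hglim
  have h1 : Tendsto (fun n ↦ ∫ ω, g n ω ∂μ) atTop (𝓝 (∫ ω, f ω ∂μ)) :=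
    tendsto_integral_of_dominated_convergence (fun _ ↦ C)
      (fun n ↦ (hgm n).aestronglyMeasurable) (integrable_const C)
      (fun n ↦ .of_forall (hgb n)) hμlim
  have h2 : Tendsto (fun n ↦ ∫ ω, Real.exp (g n ω) ∂ν) atTop (𝓝 (∫ ω, Real.exp (f ω) ∂ν)) := by
    refine tendsto_integral_of_dominated_convergence (fun _ ↦ Real.exp C)
      (fun n ↦ (hgm n).exp.aestronglyMeasurable) (integrable_const _)
      (fun n ↦ .of_forall fun ω ↦ ?_) ?_
    · rw [Real.norm_eq_abs, Real.abs_exp]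
      exact Real.exp_le_exp.2 ((le_abs_self _).trans (hgb n ω))
    · filter_upwards [hνlim] with ω hω using (Real.continuous_exp.tendsto _).comp hω
  have h3 := ENNReal.tendsto_ofReal (h1.sub (h2.log (integral_exp_pos_of_abs_le hf hC).ne'))
  exact le_of_tendsto' h3 fun n ↦ le_iSup_of_le n <| le_iSup_of_le (g n) <|
    le_iSup_of_le (hgF n) <| le_iSup_of_le ⟨C, hgb n⟩ le_rfl

/-- Laws of two maps which generate each other have the same divergence. -/
lemma klDiv_map_eq_of_comp {F : Type*} {mF : MeasurableSpace F} (μ ν : Measure Ω)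
    [IsFiniteMeasure μ] [IsFiniteMeasure ν] {f : Ω → E} {φ : E → F} {ψ : F → E}
    (hf : Measurable f) (hφ : Measurable φ) (hψ : Measurable ψ) (h : ∀ ω, ψ (φ (f ω)) = f ω) :
    klDiv (μ.map fun ω ↦ φ (f ω)) (ν.map fun ω ↦ φ (f ω)) = klDiv (μ.map f) (ν.map f) := by
  have h1 (ρ : Measure Ω) : (ρ.map fun ω ↦ φ (f ω)) = (ρ.map f).map φ :=
    (Measure.map_map hφ hf).symm
  have h2 (ρ : Measure Ω) : ((ρ.map f).map φ).map ψ = ρ.map f := by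
    rw [Measure.map_map hφ hf, Measure.map_map hψ (hφ.comp hf)]
    exact congrArg (Measure.map · ρ) (funext h)
  apply le_antisymm
  · rw [h1, h1]
    exact klDiv_map_le _ _ hφ
  · rw [h1, h1]
    calc klDiv (μ.map f) (ν.map f)
      = klDiv (((μ.map f).map φ).map ψ) (((ν.map f).map φ).map ψ) := by rw [h2, h2]
      _ ≤ _ := klDiv_map_le _ _ hψ

/-- By Lusin-Souslin, an injective measurable map of standard Borel spaces has a measurable left
inverse, so data processing applies both ways. -/
lemma klDiv_map_eq_of_injective {F : Type*} {mF : MeasurableSpace F} [StandardBorelSpace E]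
    [Nonempty E] [StandardBorelSpace F] (μ ν : Measure Ω)
    [IsFiniteMeasure μ] [IsFiniteMeasure ν] {f : Ω → E} {φ : E → F}
    (hf : Measurable f) (hφ : Measurable φ) (hinj : Function.Injective φ) :
    klDiv (μ.map fun ω ↦ φ (f ω)) (ν.map fun ω ↦ φ (f ω)) = klDiv (μ.map f) (ν.map f) :=
  have he := hφ.measurableEmbedding hinj
  klDiv_map_eq_of_comp μ ν hf hφ he.measurable_invFun fun ω ↦ he.leftInverse_invFun (f ω)

end SubSigmaAlgebra

/-! ### The chain rule -/

section ChainRule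

variable {Ω A B : Type*} {mΩ : MeasurableSpace Ω} {mA : MeasurableSpace A} {mB : MeasurableSpace B}
  [MeasurableSpace.CountableOrCountablyGenerated A B]

/-- The divergence of composition-products over the same measure is the conditional divergence. -/
theorem klDiv_compProd_right (μ : Measure A) [IsProbabilityMeasure μ] (κ η : Kernel A B)
    [IsMarkovKernel κ] [IsMarkovKernel η] :
    klDiv (μ ⊗ₘ κ) (μ ⊗ₘ η) = ∫⁻ a, klDiv (κ a) (η a) ∂μ := by
  by_cases hac : ∀ᵐ a ∂μ, κ a ≪ η a
  · have hac' : μ ⊗ₘ κ ≪ μ ⊗ₘ η := Measure.absolutelyContinuous_compProd_right_iff.2 hac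
    -- The jointly measurable kernel density is the density of the composition-products, so Fubini
    -- applies to its `klFun`.
    have hwd : μ ⊗ₘ κ = (μ ⊗ₘ η).withDensity fun p ↦ κ.rnDeriv η p.1 p.2 := by
      ext s hs
      rw [withDensity_apply _ hs, ← lintegral_indicator hs, Measure.compProd_apply hs,
        Measure.lintegral_compProd ((Kernel.measurable_rnDeriv κ η).indicator hs)]
      refine lintegral_congr_ae ?_
      filter_upwards [hac] with a ha
      have hsa : MeasurableSet (Prod.mk a ⁻¹' s) := measurable_prodMk_left hs
      conv_lhs => rw [← Measure.withDensity_rnDeriv_eq _ _ ha]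
      rw [withDensity_apply _ hsa, ← lintegral_indicator hsa]
      refine lintegral_congr_ae ?_
      filter_upwards [Kernel.rnDeriv_eq_rnDeriv_measure (κ := κ) (η := η) (a := a)] with b hb
      by_cases hmem : (a, b) ∈ s
      · rw [indicator_of_mem (show b ∈ Prod.mk a ⁻¹' s from hmem), indicator_of_mem hmem, hb]
      · rw [indicator_of_notMem (show b ∉ Prod.mk a ⁻¹' s from hmem), indicator_of_notMem hmem]
    have hrn : (μ ⊗ₘ κ).rnDeriv (μ ⊗ₘ η) =ᵐ[μ ⊗ₘ η] fun p ↦ κ.rnDeriv η p.1 p.2 := by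
      rw [hwd]
      exact Measure.rnDeriv_withDensity _ (Kernel.measurable_rnDeriv κ η)
    have hm : Measurable fun p : A × B ↦ ENNReal.ofReal (klFun (κ.rnDeriv η p.1 p.2).toReal) := by
      fun_prop
    rw [klDiv_eq_lintegral_klFun_of_ac hac']
    calc ∫⁻ p, ENNReal.ofReal (klFun ((μ ⊗ₘ κ).rnDeriv (μ ⊗ₘ η) p).toReal) ∂(μ ⊗ₘ η)
      = ∫⁻ p, ENNReal.ofReal (klFun (κ.rnDeriv η p.1 p.2).toReal) ∂(μ ⊗ₘ η) := by
          refine lintegral_congr_ae ?_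
          filter_upwards [hrn] with p hp
          rw [hp]
      _ = ∫⁻ a, ∫⁻ b, ENNReal.ofReal (klFun (κ.rnDeriv η a b).toReal) ∂(η a) ∂μ :=
          Measure.lintegral_compProd hm
      _ = ∫⁻ a, klDiv (κ a) (η a) ∂μ := by
          refine lintegral_congr_ae ?_
          filter_upwards [hac] with a ha
          rw [klDiv_eq_lintegral_klFun_of_ac ha]
          refine lintegral_congr_ae ?_
          filter_upwards [Kernel.rnDeriv_eq_rnDeriv_measure (κ := κ) (η := η) (a := a)] with b hb
          rw [hb]
  -- Otherwise the integrand is `∞` on a set of positive measure.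
  · rw [klDiv_of_not_ac (mt Measure.absolutelyContinuous_compProd_right_iff.1 hac)]
    have hS : MeasurableSet {a | κ a ≪ η a} := Kernel.measurableSet_absolutelyContinuous κ η
    have hne : μ {a | κ a ≪ η a}ᶜ ≠ 0 := hac
    symm
    rw [eq_top_iff]
    calc (∞ : ℝ≥0∞) = ∫⁻ _ in {a | κ a ≪ η a}ᶜ, ∞ ∂μ := by
          rw [setLIntegral_const, ENNReal.top_mul hne]
      _ ≤ ∫⁻ a in {a | κ a ≪ η a}ᶜ, klDiv (κ a) (η a) ∂μ :=
          setLIntegral_mono' hS.compl fun a ha ↦ (klDiv_of_not_ac ha).ge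
      _ ≤ _ := setLIntegral_le_lintegral _ _

/-- The **chain rule** for the joint laws of two random variables. -/
theorem klDiv_map_prodMk {μ ν : Measure Ω} [IsProbabilityMeasure μ] [IsProbabilityMeasure ν]
    {X : Ω → A} {Y : Ω → B} {κ η : Kernel A B} [IsMarkovKernel κ] [IsMarkovKernel η]
    (hμ : HasCondDistrib Y X κ μ) (hν : HasCondDistrib Y X η ν) :
    klDiv (μ.map fun ω ↦ (X ω, Y ω)) (ν.map fun ω ↦ (X ω, Y ω)) =
      klDiv (μ.map X) (ν.map X) + ∫⁻ a, klDiv (κ a) (η a) ∂(μ.map X) := by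
  have := Measure.isProbabilityMeasure_map hμ.aemeasurable_fst
  have := Measure.isProbabilityMeasure_map hν.aemeasurable_fst
  rw [hμ.map_eq, hν.map_eq, klDiv_compProd_eq_add, klDiv_compProd_right]

end ChainRule

/-! ### Path spaces and dense sequences of partitions -/

section PathSpace

variable {d : ℕ}

lemma measurable_restrictPath {s t u v : ℝ} (h : Icc u v ⊆ Icc s t) :
    Measurable (restrictPath (d := d) h) :=
  (ContinuousMap.continuous_precomp _).measurable

lemma measurable_evalPath {s t : ℝ} (r : Icc s t) : Measurable fun x : PathSpace d s t ↦ x r :=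
  (continuous_eval_const r).measurable

lemma measurable_skeleton {m : ℕ} {T : ℝ} (σ : Fin m → Icc (0 : ℝ) T) :
    Measurable (skeleton (d := d) σ) :=
  measurable_pi_lambda _ fun i ↦ measurable_evalPath (σ i)

lemma measurable_pastPath {T : ℝ} (s : Icc (0 : ℝ) T) : Measurable (pastPath (d := d) s) :=
  measurable_restrictPath _

lemma measurable_futurePath {T : ℝ} (s : Icc (0 : ℝ) T) : Measurable (futurePath (d := d) s) :=
  measurable_restrictPath _

/-- The evaluations at a dense set of times generate the Borel σ-algebra of the path space. -/
lemma le_iSup_comap_skeleton {T : ℝ} {n : ℕ → ℕ} (σ : ∀ k, Fin (n k) → Icc (0 : ℝ) T)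
    (hσ : Dense (⋃ k, range (σ k))) :
    PathSpace.measurableSpace d 0 T ≤
      ⨆ k, MeasurableSpace.comap (skeleton (d := d) (σ k)) inferInstance := by
  let D : Set (Icc (0 : ℝ) T) := ⋃ k, range (σ k)
  have : Countable D := (countable_iUnion fun k ↦ countable_range (σ k)).to_subtype
  -- Countability of `D` makes the target standard Borel, and density makes `φ` injective; hence `φ`
  -- is a measurable embedding and its coordinates generate the Borel σ-algebra.
  let φ : PathSpace d 0 T → D → EuclideanSpace ℝ (Fin d) := fun x r ↦ x r
  have hφ : Measurable φ := measurable_pi_lambda _ fun r ↦ measurable_evalPath r.1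
  have hinj : Function.Injective φ := fun x y h ↦ by
    ext1 r
    exact congrFun (x.continuous.ext_on hσ y.continuous fun r hr ↦ congrFun h ⟨r, hr⟩) r
  rw [← (hφ.measurableEmbedding hinj).comap_eq]
  refine Measurable.comap_le (@measurable_pi_lambda _ _ _ (_) _ _ fun r ↦ ?_)
  obtain ⟨k, i, hi⟩ := mem_iUnion.1 r.2
  have h1 : Measurable[MeasurableSpace.comap (skeleton (d := d) (σ k)) inferInstance]
      fun x : PathSpace d 0 T ↦ x (σ k i) :=
    (measurable_pi_apply i).comp (comap_measurable (skeleton (d := d) (σ k)))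
  rw [hi] at h1
  exact h1.mono (le_iSup (fun k ↦ MeasurableSpace.comap (skeleton (d := d) (σ k)) inferInstance) k)
    le_rfl

lemma comap_skeleton_mono {m n : ℕ} {T : ℝ} {σ : Fin m → Icc (0 : ℝ) T} {τ : Fin n → Icc (0 : ℝ) T}
    (h : range σ ⊆ range τ) :
    MeasurableSpace.comap (skeleton (d := d) σ) inferInstance ≤
      MeasurableSpace.comap (skeleton (d := d) τ) inferInstance := by
  choose j hj using fun i ↦ h (mem_range_self i)
  have : skeleton (d := d) σ = (fun y i ↦ y (j i)) ∘ skeleton τ := by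
    ext1 x
    ext1 i
    simp [skeleton, hj]
  rw [this, ← MeasurableSpace.comap_comp]
  exact MeasurableSpace.comap_mono
    (Measurable.comap_le (measurable_pi_lambda _ fun i ↦ measurable_pi_apply (j i)))

/-- There is a refining sequence of full partitions whose union is dense. -/
lemma exists_isFullPartition_seq {T : ℝ} (hT : 0 ≤ T) :
    ∃ (n : ℕ → ℕ) (σ : ∀ k, Fin (n k + 1) → Icc (0 : ℝ) T),
      (∀ k, IsFullPartition (σ k)) ∧ (Monotone fun k ↦ range (σ k)) ∧
        Dense (⋃ k, range (σ k)) := by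
  classical
  have : Nonempty (Icc (0 : ℝ) T) := ⟨⟨0, left_mem_Icc.2 hT⟩⟩
  let a : Icc (0 : ℝ) T := ⟨0, left_mem_Icc.2 hT⟩
  let b : Icc (0 : ℝ) T := ⟨T, right_mem_Icc.2 hT⟩
  -- Points may coincide (also `a = b` if `T = 0`), so the length is read off from the cardinality.
  let S (k : ℕ) : Finset (Icc (0 : ℝ) T) :=
    insert a (insert b ((Finset.range k).image (TopologicalSpace.denseSeq (Icc (0 : ℝ) T))))
  have ha (k : ℕ) : a ∈ S k := Finset.mem_insert_self _ _
  have hb (k : ℕ) : b ∈ S k := Finset.mem_insert_of_mem (Finset.mem_insert_self _ _)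
  have hcard (k : ℕ) : (S k).card = ((S k).card - 1) + 1 :=
    (Nat.sub_add_cancel (Finset.card_pos.2 ⟨a, ha k⟩)).symm
  have hrange (k : ℕ) : range ((S k).orderEmbOfFin (hcard k)) = S k :=
    Finset.range_orderEmbOfFin _ _
  refine ⟨fun k ↦ (S k).card - 1, fun k ↦ (S k).orderEmbOfFin (hcard k), fun k ↦ ⟨?_, ?_, ?_⟩,
    ?_, ?_⟩
  · exact ((S k).orderEmbOfFin (hcard k)).strictMono
  · obtain ⟨i, hi⟩ : a ∈ range ((S k).orderEmbOfFin (hcard k)) := by rw [hrange]; exact ha k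
    have h := ((S k).orderEmbOfFin (hcard k)).monotone (Fin.zero_le i)
    rw [hi] at h
    exact le_antisymm h ((S k).orderEmbOfFin (hcard k) 0).2.1
  · obtain ⟨i, hi⟩ : b ∈ range ((S k).orderEmbOfFin (hcard k)) := by rw [hrange]; exact hb k
    have h := ((S k).orderEmbOfFin (hcard k)).monotone (Fin.le_last i)
    rw [hi] at h
    exact le_antisymm ((S k).orderEmbOfFin (hcard k) (Fin.last _)).2.2 h
  · intro k l hkl
    simp only [hrange]
    exact Finset.coe_subset.2 <| Finset.insert_subset_insert _ <| Finset.insert_subset_insert _ <|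
      Finset.image_subset_image (Finset.range_subset_range.2 hkl)
  · refine (TopologicalSpace.denseRange_denseSeq (Icc (0 : ℝ) T)).mono ?_
    rintro _ ⟨k, rfl⟩
    refine mem_iUnion.2 ⟨k + 1, ?_⟩
    rw [hrange]
    exact Finset.mem_insert_of_mem <| Finset.mem_insert_of_mem <|
      Finset.mem_image_of_mem _ (Finset.self_mem_range_succ k)

end PathSpace

/-! ### The Markov property in terms of conditional distributions -/

section Markov

variable {d : ℕ} {T : ℝ}

lemma hasCondDistrib_condDistrib {Ω A B : Type*} {mΩ : MeasurableSpace Ω} {mA : MeasurableSpace A}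
    {mB : MeasurableSpace B} [StandardBorelSpace B] [Nonempty B] (μ : Measure Ω)
    [IsFiniteMeasure μ] {X : Ω → A} {Y : Ω → B} (hX : Measurable X) (hY : Measurable Y) :
    HasCondDistrib Y X (condDistrib Y X μ) μ :=
  ⟨by fun_prop, (compProd_map_condDistrib hY.aemeasurable).symm⟩

/-- For a Markov law, the laws given the state are also the laws given the past. -/
theorem IsMarkovLaw.hasCondDistrib_pastPath {P : Measure (PathSpace d 0 T)} [IsProbabilityMeasure P]
    (hP : IsMarkovLaw P)
    {κ : ∀ s : Icc (0 : ℝ) T, Kernel (EuclideanSpace ℝ (Fin d)) (PathSpace d s T)}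
    (hκ : IsStateRcp P κ) (s : Icc (0 : ℝ) T) :
    HasCondDistrib (futurePath s) (pastPath s)
      ((κ s).comap (fun x : PathSpace d 0 s ↦ x ⟨s, right_mem_Icc.2 s.2.1⟩)
        (measurable_evalPath _)) P := by
  have := hκ.isMarkovKernel s
  have hpast := measurable_pastPath (d := d) s
  have hfut := measurable_futurePath (d := d) s
  have heval := measurable_evalPath (d := d) s
  set e : PathSpace d 0 s → EuclideanSpace ℝ (Fin d) := fun x ↦ x ⟨s, right_mem_Icc.2 s.2.1⟩
  have he : Measurable e := measurable_evalPath _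
  have hstate : ∀ᵐ x ∂P, condDistrib (futurePath s) (fun x ↦ x s) P (x s) = κ s (x s) :=
    ae_of_ae_map heval.aemeasurable
      (condDistrib_ae_eq_of_measure_eq_compProd _ hfut.aemeasurable (hκ.hasCondDistrib s).map_eq)
  -- On path space both sides are conditional probabilities of the same future event, given the past
  -- and given the state, which the Markov property equates. The null set depends on `B`; this
  -- suffices because the joint laws need only agree on rectangles.
  have key {B : Set (PathSpace d s T)} (hB : MeasurableSet B) :
      ∀ᵐ a ∂(P.map (pastPath s)),
        condDistrib (futurePath s) (pastPath s) P a B = κ s (e a) B := by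
    have hm : Measurable fun a ↦ κ s (e a) B := (Kernel.measurable_coe _ hB).comp he
    rw [ae_map_iff hpast.aemeasurable (measurableSet_eq_fun (Kernel.measurable_coe _ hB) hm)]
    filter_upwards [condDistrib_ae_eq_condExp (μ := P) hpast hfut hB,
      condDistrib_ae_eq_condExp (μ := P) heval hfut hB, hP s (futurePath s ⁻¹' B) ⟨B, hB, rfl⟩,
      hstate] with x h1 h2 h3 h4
    rw [h4] at h2
    have h5 := (h1.trans h3).trans h2.symm
    exact (ENNReal.toReal_eq_toReal_iff' (measure_ne_top _ _) (measure_ne_top _ _)).1 h5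
  refine ⟨by fun_prop, ?_⟩
  rw [← compProd_map_condDistrib hfut.aemeasurable]
  have := Measure.isProbabilityMeasure_map (μ := P) hpast.aemeasurable
  rw [Measure.ext_prod_iff]
  intro A B hA hB
  rw [Measure.compProd_apply_prod hA hB, Measure.compProd_apply_prod hA hB]
  refine setLIntegral_congr_fun_ae hA ?_
  filter_upwards [key hB] with a ha _ using ha

variable {P μ : Measure (PathSpace d 0 T)} [IsProbabilityMeasure P] [IsProbabilityMeasure μ]
  {κ : ∀ s : Icc (0 : ℝ) T, Kernel (EuclideanSpace ℝ (Fin d)) (PathSpace d s T)}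

/-- The kernel `z ↦ κ(z)_t` obtained from a kernel into the paths on `[s,T]`. -/
noncomputable def lawAtKernel {A : Type*} {mA : MeasurableSpace A} {s t : Icc (0 : ℝ) T}
    (hst : s ≤ t) (K : Kernel A (PathSpace d s T)) : Kernel A (EuclideanSpace ℝ (Fin d)) :=
  K.map fun w ↦ w ⟨t, hst, t.2.2⟩

lemma lawAtKernel_apply {A : Type*} {mA : MeasurableSpace A} {s t : Icc (0 : ℝ) T}
    (hst : s ≤ t) (K : Kernel A (PathSpace d s T)) (a : A) :
    lawAtKernel hst K a = lawAt hst (K a) :=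
  Kernel.map_apply _ (measurable_evalPath _) _

instance {A : Type*} {mA : MeasurableSpace A} {s t : Icc (0 : ℝ) T}
    (hst : s ≤ t) (K : Kernel A (PathSpace d s T)) [IsMarkovKernel K] :
    IsMarkovKernel (lawAtKernel hst K) :=
  Kernel.IsMarkovKernel.map _ (measurable_evalPath _)

lemma _root_.ProbabilityTheory.HasCondDistrib.lawAtKernel {A : Type*} {mA : MeasurableSpace A}
    {s t : Icc (0 : ℝ) T} (hst : s ≤ t) {K : Kernel A (PathSpace d s T)} [IsMarkovKernel K]
    {X : PathSpace d 0 T → A} (h : HasCondDistrib (futurePath s) X K μ) :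
    HasCondDistrib (fun x ↦ x t) X (_root_.lawAtKernel hst K) μ :=
  h.comp_left (f := fun w ↦ w ⟨t, hst, t.2.2⟩) (measurable_evalPath _)

instance (s : Icc (0 : ℝ) T) : IsMarkovKernel (rcpPast μ s) := by
  unfold rcpPast; infer_instance

instance {m : ℕ} (σ : Fin m → Icc (0 : ℝ) T) (s : Icc (0 : ℝ) T) :
    IsMarkovKernel (rcpSkeleton μ σ s) := by
  unfold rcpSkeleton; infer_instance

lemma hasCondDistrib_rcpPast (s : Icc (0 : ℝ) T) :
    HasCondDistrib (futurePath s) (pastPath s) (rcpPast μ s) μ :=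
  hasCondDistrib_condDistrib μ (measurable_pastPath s) (measurable_futurePath s)

lemma hasCondDistrib_rcpSkeleton {m : ℕ} (σ : Fin m → Icc (0 : ℝ) T) (s : Icc (0 : ℝ) T) :
    HasCondDistrib (futurePath s) (skeleton σ) (rcpSkeleton μ σ s) μ :=
  hasCondDistrib_condDistrib μ (measurable_skeleton σ) (measurable_futurePath s)

/-- The inclusion of `[0,s]` in `[0,T]`. -/
def inclTime (s : Icc (0 : ℝ) T) (r : Icc (0 : ℝ) s) : Icc (0 : ℝ) T :=
  ⟨r, r.2.1, r.2.2.trans s.2.2⟩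

/-- For a Markov law, the laws given the state are also the laws given finitely many past states
that include the present one. -/
lemma IsMarkovLaw.hasCondDistrib_skeleton (hP : IsMarkovLaw P) (hκ : IsStateRcp P κ)
    (s : Icc (0 : ℝ) T) {m : ℕ} (σ : Fin (m + 1) → Icc (0 : ℝ) T) (hσ : ∀ i, σ i ≤ s)
    (hlast : σ (Fin.last m) = s) :
    HasCondDistrib (futurePath s) (skeleton σ)
      ((κ s).comap (fun y ↦ y (Fin.last m)) (measurable_pi_apply _)) P := by
  have := hκ.isMarkovKernel s
  subst hlast
  have hf := measurable_skeleton (d := d) fun i ↦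
    (⟨σ i, (σ i).2.1, hσ i⟩ : Icc (0 : ℝ) (σ (Fin.last m)))
  -- The kernel given the past sees only the last coordinate of the skeleton, so it remains a
  -- conditional law when the past is coarsened to the skeleton.
  exact HasCondDistrib.comp_right (hf := hf)
    (κ := (κ (σ (Fin.last m))).comap (fun y ↦ y (Fin.last m)) (measurable_pi_apply _)) (hP.hasCondDistrib_pastPath hκ _)

end Markov

/-! ### Additivity along partitions and the supremum over skeletons -/

section Identities

variable {d : ℕ} {T : ℝ} {P μ : Measure (PathSpace d 0 T)} [IsProbabilityMeasure P]
  [IsProbabilityMeasure μ]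
  {κ : ∀ s : Icc (0 : ℝ) T, Kernel (EuclideanSpace ℝ (Fin d)) (PathSpace d s T)}

lemma isProbabilityMeasure_lawAt {s t : Icc (0 : ℝ) T} (hst : s ≤ t) (ν : Measure (PathSpace d s T))
    [IsProbabilityMeasure ν] : IsProbabilityMeasure (lawAt hst ν) :=
  Measure.isProbabilityMeasure_map (measurable_evalPath _).aemeasurable

/-- Telescoping without subtraction, which would fail at `∞`. -/
lemma eq_add_sum_of_succ {n : ℕ} (a : Fin (n + 1) → ℝ≥0∞) (b : Fin n → ℝ≥0∞)
    (h : ∀ j, a j.succ = a j.castSucc + b j) : a (Fin.last n) = a 0 + ∑ j, b j := by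
  induction n with
  | zero => simp
  | succ n ih =>
    rw [Fin.sum_univ_castSucc, ← add_assoc, ← Fin.succ_last, h]
    congr 1
    exact ih (fun i ↦ a i.castSucc) (fun j ↦ b j.castSucc) fun j ↦ h j.castSucc

/-- The divergence of the laws on `[0,t]` splits at an earlier time `s`. -/
lemma klDiv_map_pastPath_eq_add (hP : IsMarkovLaw P) (hκ : IsStateRcp P κ) {s t : Icc (0 : ℝ) T}
    (hst : s ≤ t) :
    klDiv (μ.map (pastPath t)) (P.map (pastPath t)) =
      klDiv (μ.map (pastPath s)) (P.map (pastPath s)) +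
        ∫⁻ x, relEntropyOn (windowSigma d (Icc_subset_Icc (le_refl (s : ℝ)) t.2.2))
          (rcpPast μ s x) (κ s (x ⟨s, right_mem_Icc.2 s.2.1⟩)) ∂(μ.map (pastPath s)) := by
  have := hκ.isMarkovKernel s
  let w : PathSpace d s T → PathSpace d s t :=
    restrictPath (Icc_subset_Icc (le_refl (s : ℝ)) t.2.2)
  have hw : Measurable w := measurable_restrictPath _
  -- Cutting at `s` loses nothing, so the chain rule can be applied to the two pieces.
  let φ : PathSpace d 0 t → PathSpace d 0 s × PathSpace d s t := fun x ↦
    (restrictPath (Icc_subset_Icc le_rfl hst) x, restrictPath (Icc_subset_Icc s.2.1 le_rfl) x)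
  have hφ : Measurable φ := (measurable_restrictPath _).prodMk (measurable_restrictPath _)
  have hinj : Function.Injective φ := fun x y hxy ↦ by
    ext1 r
    rcases le_total (r : ℝ) s with hr | hr
    · exact DFunLike.congr_fun (congrArg Prod.fst hxy) ⟨r, r.2.1, hr⟩
    · exact DFunLike.congr_fun (congrArg Prod.snd hxy) ⟨r, hr, r.2.2⟩
  rw [← klDiv_map_eq_of_injective μ P (measurable_pastPath t) hφ hinj]
  have hμ := (hasCondDistrib_rcpPast (μ := μ) s).comp_left hw
  have hP' := (hP.hasCondDistrib_pastPath hκ s).comp_left hw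
  have := Kernel.IsMarkovKernel.map (rcpPast μ s) hw
  have := Kernel.IsMarkovKernel.map ((κ s).comap
    (fun x : PathSpace d 0 s ↦ x ⟨s, right_mem_Icc.2 s.2.1⟩) (measurable_evalPath _)) hw
  refine (klDiv_map_prodMk hμ hP').trans ?_
  congr 1
  refine lintegral_congr fun x ↦ ?_
  rw [Kernel.map_apply _ hw, Kernel.map_apply _ hw, Kernel.comap_apply]
  exact (relEntropyOn_comap _ _ hw).symm

/-- A path on a one-point interval is determined by its value; this starts the telescoping. -/
lemma klDiv_map_pastPath_zero {s : Icc (0 : ℝ) T} (hs : (s : ℝ) = 0) (hT : 0 ≤ T) :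
    klDiv (μ.map (pastPath s)) (P.map (pastPath s)) =
      relEntropyOn (timeSigma d ⟨0, left_mem_Icc.2 hT⟩) μ P := by
  have hφ : Measurable fun x : PathSpace d 0 s ↦ x ⟨0, left_mem_Icc.2 s.2.1⟩ :=
    measurable_evalPath _
  refine Eq.trans ?_ (relEntropyOn_comap μ P (measurable_evalPath ⟨0, left_mem_Icc.2 hT⟩)).symm
  refine (klDiv_map_eq_of_injective μ P (measurable_pastPath s) hφ fun x y hxy ↦ ?_).symm
  ext1 r
  have hr : r = ⟨0, left_mem_Icc.2 s.2.1⟩ :=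
    Subtype.ext (le_antisymm (r.2.2.trans_eq hs) r.2.1)
  rw [hr]
  exact hxy

lemma klDiv_map_pastPath_last {s : Icc (0 : ℝ) T} (hs : (s : ℝ) = T) :
    klDiv (μ.map (pastPath s)) (P.map (pastPath s)) = relEntropy μ P := by
  rw [relEntropy_eq_klDiv]
  refine (klDiv_map_eq_of_injective μ P measurable_id (measurable_pastPath s) fun x y hxy ↦ ?_).trans
    (by rw [Measure.map_id, Measure.map_id])
  ext1 r
  exact DFunLike.congr_fun hxy ⟨r, r.2.1, r.2.2.trans_eq hs.symm⟩

/-- The relative entropy of path laws is additive along a partition. -/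
theorem relEntropy_eq_sum_windows (hT : 0 ≤ T) (hP : IsMarkovLaw P) (hκ : IsStateRcp P κ) {n : ℕ}
    {σ : Fin (n + 1) → Icc (0 : ℝ) T} (hσ : IsFullPartition σ) :
    relEntropy μ P =
      relEntropyOn (timeSigma d ⟨0, left_mem_Icc.2 hT⟩) μ P +
        ∑ j : Fin n,
          ∫⁻ x, relEntropyOn
              (windowSigma d (Icc_subset_Icc (le_refl (σ j.castSucc : ℝ)) (σ j.succ).2.2))
              (rcpPast μ (σ j.castSucc) x)
              (κ (σ j.castSucc) (x ⟨σ j.castSucc, right_mem_Icc.2 (σ j.castSucc).2.1⟩))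
            ∂(μ.map (pastPath (σ j.castSucc))) := by
  rw [← klDiv_map_pastPath_last hσ.last, ← klDiv_map_pastPath_zero hσ.first hT]
  exact eq_add_sum_of_succ (fun k ↦ klDiv (μ.map (pastPath (σ k))) (P.map (pastPath (σ k)))) _
    fun j ↦ klDiv_map_pastPath_eq_add hP hκ (hσ.strictMono j.castSucc_lt_succ).le

/-- The divergence of the laws of a skeleton splits off the last time. -/
lemma klDiv_map_skeleton_eq_add (hP : IsMarkovLaw P) (hκ : IsStateRcp P κ) {m : ℕ}
    (τ : Fin (m + 2) → Icc (0 : ℝ) T) (hτ : Monotone τ) :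
    klDiv (μ.map (skeleton τ)) (P.map (skeleton τ)) =
      klDiv (μ.map (skeleton fun i ↦ τ i.castSucc)) (P.map (skeleton fun i ↦ τ i.castSucc)) +
        ∫⁻ y, relEntropy
            (lawAt (hτ (Fin.castSucc_lt_succ (i := Fin.last m)).le)
              (rcpSkeleton μ (fun i ↦ τ i.castSucc) (τ (Fin.last m).castSucc) y))
            (lawAt (hτ (Fin.castSucc_lt_succ (i := Fin.last m)).le)
              (κ (τ (Fin.last m).castSucc) (y (Fin.last m))))
          ∂(μ.map (skeleton fun i ↦ τ i.castSucc)) := by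
  set σ : Fin (m + 1) → Icc (0 : ℝ) T := fun i ↦ τ i.castSucc
  have hst := hτ (Fin.castSucc_lt_succ (i := Fin.last m)).le
  have := hκ.isMarkovKernel (σ (Fin.last m))
  let φ : (Fin (m + 2) → EuclideanSpace ℝ (Fin d)) →
      (Fin (m + 1) → EuclideanSpace ℝ (Fin d)) × EuclideanSpace ℝ (Fin d) :=
    fun y ↦ (fun i ↦ y i.castSucc, y (Fin.last m).succ)
  have hφ : Measurable φ :=
    (measurable_pi_lambda _ fun i ↦ measurable_pi_apply _).prodMk (measurable_pi_apply _)
  have hinj : Function.Injective φ := fun x y hxy ↦ by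
    ext1 i
    refine Fin.lastCases ?_ (fun i ↦ ?_) i
    · exact congrArg Prod.snd hxy
    · exact congrFun (congrArg Prod.fst hxy) i
  rw [← klDiv_map_eq_of_injective μ P (measurable_skeleton τ) hφ hinj]
  have hμ := (hasCondDistrib_rcpSkeleton (μ := μ) σ (σ (Fin.last m))).lawAtKernel hst
  have hP' := (hP.hasCondDistrib_skeleton hκ (σ (Fin.last m)) σ
    (fun i ↦ hτ (Fin.castSucc_le_castSucc_iff.2 (Fin.le_last i))) rfl).lawAtKernel hst
  refine (klDiv_map_prodMk hμ hP').trans ?_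
  congr 1
  refine lintegral_congr fun y ↦ ?_
  have := isProbabilityMeasure_lawAt hst (rcpSkeleton μ σ (σ (Fin.last m)) y)
  have := isProbabilityMeasure_lawAt hst (κ (σ (Fin.last m)) (y (Fin.last m)))
  rw [lawAtKernel_apply, lawAtKernel_apply, Kernel.comap_apply]
  exact (relEntropy_eq_klDiv _ _).symm

/-- The divergence of the laws of a skeleton is additive along the skeleton. -/
theorem klDiv_map_skeleton_eq_sum (hT : 0 ≤ T) (hP : IsMarkovLaw P) (hκ : IsStateRcp P κ) {n : ℕ}
    {σ : Fin (n + 1) → Icc (0 : ℝ) T} (hσ : IsFullPartition σ) :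
    klDiv (μ.map (skeleton σ)) (P.map (skeleton σ)) =
      relEntropyOn (timeSigma d ⟨0, left_mem_Icc.2 hT⟩) μ P +
        ∑ j : Fin n,
          ∫⁻ y, relEntropy
              (lawAt (hσ.strictMono j.castSucc_lt_succ).le
                (rcpSkeleton μ (initialSegment σ j) (σ j.castSucc) y))
              (lawAt (hσ.strictMono j.castSucc_lt_succ).le
                (κ (σ j.castSucc) (y (Fin.last j))))
            ∂(μ.map (skeleton (initialSegment σ j))) := by
  -- Extends `initialSegment` by one index: the last segment is `σ` itself, the endpoint of the
  -- telescoping.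
  let seg (k : Fin (n + 1)) : Fin (k + 1) → Icc (0 : ℝ) T := fun i ↦ σ (Fin.castLE (by omega) i)
  have h0 : klDiv (μ.map (skeleton (seg 0))) (P.map (skeleton (seg 0))) =
      relEntropyOn (timeSigma d ⟨0, left_mem_Icc.2 hT⟩) μ P := by
    rw [relEntropyOn_comap μ P (measurable_evalPath _)]
    have hψ : Measurable fun y : Fin 1 → EuclideanSpace ℝ (Fin d) ↦ y 0 := measurable_pi_apply _
    have hfirst : σ 0 = ⟨0, left_mem_Icc.2 hT⟩ := Subtype.ext hσ.first
    rw [← hfirst]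
    refine (klDiv_map_eq_of_injective μ P (measurable_skeleton (seg 0)) hψ fun x y hxy ↦ ?_).symm
    ext1 i
    have hi : i = (0 : Fin 1) := Subsingleton.elim (α := Fin 1) i 0
    rw [hi]
    exact hxy
  rw [← h0]
  exact eq_add_sum_of_succ (fun k ↦ klDiv (μ.map (skeleton (seg k))) (P.map (skeleton (seg k)))) _
    fun j ↦ klDiv_map_skeleton_eq_add hP hκ (fun i : Fin (j + 2) ↦ σ (Fin.castLE (by omega) i))
      fun i i' h ↦ hσ.strictMono.monotone (Fin.castLE_le_castLE_iff _ |>.2 h)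

lemma klDiv_map_skeleton_le {n : ℕ} (σ : Fin n → Icc (0 : ℝ) T) :
    klDiv (μ.map (skeleton σ)) (P.map (skeleton σ)) ≤ relEntropy μ P := by
  rw [relEntropy_eq_klDiv]
  exact klDiv_map_le μ P (measurable_skeleton σ)

/-- The relative entropy of path laws is the supremum over the finite-dimensional laws. -/
theorem relEntropy_eq_iSup_skeleton (hT : 0 ≤ T) (hP : IsMarkovLaw P) (hκ : IsStateRcp P κ) :
    relEntropy μ P =
      relEntropyOn (timeSigma d ⟨0, left_mem_Icc.2 hT⟩) μ P +
        ⨆ (n : ℕ) (σ : Fin (n + 1) → Icc (0 : ℝ) T) (hσ : IsFullPartition σ),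
          ∑ j : Fin n,
            ∫⁻ y, relEntropy
                (lawAt (hσ.strictMono j.castSucc_lt_succ).le
                  (rcpSkeleton μ (initialSegment σ j) (σ j.castSucc) y))
                (lawAt (hσ.strictMono j.castSucc_lt_succ).le
                  (κ (σ j.castSucc) (y (Fin.last j))))
              ∂(μ.map (skeleton (initialSegment σ j))) := by
  obtain ⟨n, σ, hσ, hmono, hdense⟩ := exists_isFullPartition_seq hT
  apply le_antisymm
  · let ℱ : Filtration ℕ (PathSpace.measurableSpace d 0 T) :=
      { seq k := MeasurableSpace.comap (skeleton (σ k)) inferInstance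
        mono' _ _ h := comap_skeleton_mono (hmono h)
        le' k := (measurable_skeleton (σ k)).comap_le }
    refine (relEntropy_le_iSup_relEntropyOn μ P ℱ (le_iSup_comap_skeleton σ hdense)).trans
      (iSup_le fun k ↦ ?_)
    refine (relEntropyOn_comap μ P (measurable_skeleton (σ k))).trans_le ?_
    rw [klDiv_map_skeleton_eq_sum hT hP hκ (hσ k)]
    gcongr
    exact le_iSup_of_le (n k) <| le_iSup_of_le (σ k) <| le_iSup_of_le (hσ k) le_rfl
  -- A finite initial term can be subtracted, which reduces the bound on the supremum to one
  -- partition at a time. If it is infinite, any one partition already forces the path entropy to be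
  -- infinite.
  · by_cases htop : relEntropyOn (timeSigma d ⟨0, left_mem_Icc.2 hT⟩) μ P = ∞
    · have h := klDiv_map_skeleton_eq_sum (μ := μ) hT hP hκ (hσ 0)
      rw [htop, top_add] at h
      have htop' : relEntropy μ P = ∞ := top_le_iff.1 (h.symm.trans_le (klDiv_map_skeleton_le _))
      exact le_top.trans_eq htop'.symm
    · rw [← ENNReal.le_sub_iff_add_le_left htop
        ((le_self_add.trans_eq (klDiv_map_skeleton_eq_sum hT hP hκ (hσ 0)).symm).trans
          (klDiv_map_skeleton_le _))]
      refine iSup_le fun n ↦ iSup_le fun σ ↦ iSup_le fun hσ ↦ ?_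
      refine ENNReal.le_sub_of_add_le_left htop ?_
      rw [← klDiv_map_skeleton_eq_sum hT hP hκ hσ]
      exact klDiv_map_skeleton_le σ

end Identities

/-! ### Conditioning on the past at a single time -/

section SingleTime

variable {d : ℕ} {T : ℝ} {μ : Measure (PathSpace d 0 T)} [IsProbabilityMeasure μ]
  {s t : Icc (0 : ℝ) T}

/-- The conditional relative entropy given the past is the supremum of those given finitely many
past states. -/
theorem lintegral_relEntropy_rcpPast_eq_iSup (hst : s ≤ t)
    (K : Kernel (EuclideanSpace ℝ (Fin d)) (PathSpace d s T)) [IsMarkovKernel K] :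
    ∫⁻ x, relEntropy (lawAt hst (rcpPast μ s x))
        (lawAt hst (K (x ⟨s, right_mem_Icc.2 s.2.1⟩))) ∂(μ.map (pastPath s)) =
      ⨆ (n : ℕ) (σ : Fin (n + 1) → Icc (0 : ℝ) T) (_ : StrictMono σ) (_ : σ (Fin.last n) = s),
        ∫⁻ y, relEntropy (lawAt hst (rcpSkeleton μ σ s y)) (lawAt hst (K (y (Fin.last n))))
          ∂(μ.map (skeleton σ)) := by
  have hpast := measurable_pastPath (d := d) s
  have := Measure.isProbabilityMeasure_map (μ := μ) hpast.aemeasurable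
  let e : PathSpace d 0 s → EuclideanSpace ℝ (Fin d) := fun x ↦ x ⟨s, right_mem_Icc.2 s.2.1⟩
  have he : Measurable e := measurable_evalPath _
  let η : Kernel (PathSpace d 0 s) (EuclideanSpace ℝ (Fin d)) := (lawAtKernel hst K).comap e he
  -- `M₁` is the true joint law of past and state at `t`; `M₂` keeps the past of `μ` but makes the
  -- transition with `K`.
  let M₁ : Measure (PathSpace d 0 s × EuclideanSpace ℝ (Fin d)) :=
    μ.map fun x ↦ (pastPath s x, x t)
  let M₂ : Measure (PathSpace d 0 s × EuclideanSpace ℝ (Fin d)) := μ.map (pastPath s) ⊗ₘ η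
  have hM₁meas : Measurable fun x : PathSpace d 0 T ↦ (pastPath s x, x t) :=
    hpast.prodMk (measurable_evalPath t)
  have : IsProbabilityMeasure M₁ := Measure.isProbabilityMeasure_map hM₁meas.aemeasurable
  have hfull : ∫⁻ x, relEntropy (lawAt hst (rcpPast μ s x))
      (lawAt hst (K (x ⟨s, right_mem_Icc.2 s.2.1⟩))) ∂(μ.map (pastPath s)) = relEntropy M₁ M₂ := by
    rw [relEntropy_eq_klDiv]
    have h₁ : M₁ = μ.map (pastPath s) ⊗ₘ lawAtKernel hst (rcpPast μ s) :=
      ((hasCondDistrib_rcpPast s).lawAtKernel hst).map_eq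
    rw [h₁, klDiv_compProd_right]
    refine lintegral_congr fun x ↦ ?_
    have := isProbabilityMeasure_lawAt hst (rcpPast μ s x)
    have := isProbabilityMeasure_lawAt hst (K (e x))
    rw [lawAtKernel_apply, Kernel.comap_apply, lawAtKernel_apply]
    exact relEntropy_eq_klDiv _ _
  let π {n : ℕ} (τ : Fin (n + 1) → Icc (0 : ℝ) s)
      (p : PathSpace d 0 s × EuclideanSpace ℝ (Fin d)) :
      (Fin (n + 1) → EuclideanSpace ℝ (Fin d)) × EuclideanSpace ℝ (Fin d) := (skeleton τ p.1, p.2)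
  have hπ {n : ℕ} (τ : Fin (n + 1) → Icc (0 : ℝ) s) : Measurable (π τ) :=
    ((measurable_skeleton τ).comp measurable_fst).prodMk measurable_snd
  have hskel {n : ℕ} (τ : Fin (n + 1) → Icc (0 : ℝ) s) (hτ : (τ (Fin.last n) : ℝ) = s) :
      ∫⁻ y, relEntropy (lawAt hst (rcpSkeleton μ (fun i ↦ inclTime s (τ i)) s y))
          (lawAt hst (K (y (Fin.last n)))) ∂(μ.map (skeleton fun i ↦ inclTime s (τ i))) =
        klDiv (M₁.map (π τ)) (M₂.map (π τ)) := by
    let σ : Fin (n + 1) → Icc (0 : ℝ) T := fun i ↦ inclTime s (τ i)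
    have hσm := measurable_skeleton (d := d) σ
    have := Measure.isProbabilityMeasure_map (μ := μ) hσm.aemeasurable
    let η' : Kernel (Fin (n + 1) → EuclideanSpace ℝ (Fin d)) (EuclideanSpace ℝ (Fin d)) :=
      (lawAtKernel hst K).comap (fun y ↦ y (Fin.last n)) (measurable_pi_apply _)
    have h₁ : M₁.map (π τ) = μ.map (skeleton σ) ⊗ₘ lawAtKernel hst (rcpSkeleton μ σ s) := by
      rw [← ((hasCondDistrib_rcpSkeleton σ s).lawAtKernel hst).map_eq, Measure.map_map (hπ τ) hM₁meas]
      rfl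
    -- Since `τ` ends at `s`, the transition of `M₂` depends on the past only through the skeleton
    -- and survives the projection.
    have h₂ : M₂.map (π τ) = μ.map (skeleton σ) ⊗ₘ η' := by
      have hη : η = η'.comap (skeleton τ) (measurable_skeleton τ) := by
        ext1 x
        simp only [η, η', Kernel.comap_apply]
        congr 1
        exact congrArg x (Subtype.ext hτ.symm)
      have hfst : M₂.map Prod.fst = μ.map (pastPath s) := Measure.fst_compProd _ _
      have hcd : HasCondDistrib Prod.snd Prod.fst (η'.comap (skeleton τ) (measurable_skeleton τ))
          M₂ := ⟨by fun_prop, by rw [hfst, ← hη]; exact Measure.map_id⟩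
      refine (HasCondDistrib.comp_right hcd).map_eq.trans ?_
      rw [← Measure.map_map (measurable_skeleton τ) measurable_fst, hfst,
        Measure.map_map (measurable_skeleton τ) hpast]
      rfl
    rw [h₁, h₂, klDiv_compProd_right]
    refine lintegral_congr fun y ↦ ?_
    have := isProbabilityMeasure_lawAt hst (rcpSkeleton μ σ s y)
    have := isProbabilityMeasure_lawAt hst (K (y (Fin.last n)))
    rw [lawAtKernel_apply, Kernel.comap_apply, lawAtKernel_apply]
    exact relEntropy_eq_klDiv _ _
  rw [hfull]
  apply le_antisymm
  · obtain ⟨n, τ, hτ, hmono, hdense⟩ := exists_isFullPartition_seq s.2.1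
    have hcomap {n : ℕ} (τ : Fin (n + 1) → Icc (0 : ℝ) s) :
        MeasurableSpace.comap (π τ) inferInstance =
          (MeasurableSpace.comap (skeleton (d := d) τ) inferInstance).comap Prod.fst ⊔
            MeasurableSpace.comap Prod.snd inferInstance := by
      simp only [Prod.instMeasurableSpace, MeasurableSpace.prod, MeasurableSpace.comap_sup,
        MeasurableSpace.comap_comp]
      rfl
    -- Only the past is discretised; every stage contains the full state at `t`.
    let ℱ : Filtration ℕ (inferInstance :
        MeasurableSpace (PathSpace d 0 s × EuclideanSpace ℝ (Fin d))) :=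
      { seq k := MeasurableSpace.comap (π (τ k)) inferInstance
        mono' k l h := (hcomap (τ k)).trans_le <| (sup_le_sup_right
          (MeasurableSpace.comap_mono (comap_skeleton_mono (hmono h))) _).trans (hcomap (τ l)).ge
        le' k := (hπ (τ k)).comap_le }
    have hℱ : (inferInstance : MeasurableSpace (PathSpace d 0 s × EuclideanSpace ℝ (Fin d))) ≤
        ⨆ k, ℱ k := by
      refine sup_le ?_ ?_
      · refine (MeasurableSpace.comap_mono (le_iSup_comap_skeleton τ hdense)).trans ?_
        rw [MeasurableSpace.comap_iSup]
        exact iSup_mono fun k ↦ le_sup_left.trans (hcomap (τ k)).ge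
      · exact le_iSup_of_le 0 (le_sup_right.trans (hcomap (τ 0)).ge)
    refine (relEntropy_le_iSup_relEntropyOn M₁ M₂ ℱ hℱ).trans (iSup_le fun k ↦ ?_)
    refine (relEntropyOn_comap M₁ M₂ (hπ (τ k))).trans_le ?_
    rw [← hskel (τ k) (hτ k).last]
    exact le_iSup_of_le (n k) <| le_iSup_of_le (fun i ↦ inclTime s (τ k i)) <|
      le_iSup_of_le (fun _ _ h ↦ (hτ k).strictMono h) <|
      le_iSup_of_le (Subtype.ext (hτ k).last) le_rfl
  -- Data processing covers every finite set ending at `s`, including those without `0`.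
  · refine iSup_le fun n ↦ iSup_le fun σ ↦ iSup_le fun hσ ↦ iSup_le fun hlast ↦ ?_
    have hle (i : Fin (n + 1)) : σ i ≤ s := hlast ▸ hσ.monotone (Fin.le_last i)
    rw [relEntropy_eq_klDiv]
    exact (hskel (fun i ↦ ⟨σ i, (σ i).2.1, hle i⟩) (congrArg Subtype.val hlast)).trans_le
      (klDiv_map_le M₁ M₂ (hπ _))

end SingleTime

theorem mainTheorem6 {d : ℕ} {T : ℝ} (hT : 0 ≤ T)
    (P : Measure (PathSpace d 0 T)) [IsProbabilityMeasure P] (hP : IsMarkovLaw P)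
    (κ : ∀ s : Icc (0 : ℝ) T, Kernel (EuclideanSpace ℝ (Fin d)) (PathSpace d s T))
    (hκ : IsStateRcp P κ)
    (μ : Measure (PathSpace d 0 T)) [IsProbabilityMeasure μ] :
    (∀ (n : ℕ) (σ : Fin (n + 1) → Icc (0 : ℝ) T) (hσ : IsFullPartition σ),
      relEntropy μ P =
        relEntropyOn (timeSigma d ⟨0, left_mem_Icc.2 hT⟩) μ P +
          ∑ j : Fin n,
            ∫⁻ x, relEntropyOn
                (windowSigma d (Icc_subset_Icc (le_refl (σ j.castSucc : ℝ)) (σ j.succ).2.2))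
                (rcpPast μ (σ j.castSucc) x)
                (κ (σ j.castSucc) (x ⟨σ j.castSucc, right_mem_Icc.2 (σ j.castSucc).2.1⟩))
              ∂(μ.map (pastPath (σ j.castSucc)))) ∧
    (relEntropy μ P =
        relEntropyOn (timeSigma d ⟨0, left_mem_Icc.2 hT⟩) μ P +
          ⨆ (n : ℕ) (σ : Fin (n + 1) → Icc (0 : ℝ) T) (hσ : IsFullPartition σ),
            ∑ j : Fin n,
              ∫⁻ y, relEntropy
                  (lawAt (hσ.strictMono j.castSucc_lt_succ).le
                    (rcpSkeleton μ (initialSegment σ j) (σ j.castSucc) y))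
                  (lawAt (hσ.strictMono j.castSucc_lt_succ).le
                    (κ (σ j.castSucc) (y (Fin.last j))))
                ∂(μ.map (skeleton (initialSegment σ j)))) ∧
    (∀ (s t : Icc (0 : ℝ) T) (hst : s < t),
      ∫⁻ x, relEntropy
          (lawAt hst.le (rcpPast μ s x))
          (lawAt hst.le (κ s (x ⟨s, right_mem_Icc.2 s.2.1⟩)))
        ∂(μ.map (pastPath s)) =
      ⨆ (n : ℕ) (σ : Fin (n + 1) → Icc (0 : ℝ) T) (_ : StrictMono σ) (_ : σ (Fin.last n) = s),
        ∫⁻ y, relEntropy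
            (lawAt hst.le (rcpSkeleton μ σ s y))
            (lawAt hst.le (κ s (y (Fin.last n))))
          ∂(μ.map (skeleton σ))) :=
  ⟨fun _ _ hσ ↦ relEntropy_eq_sum_windows hT hP hκ hσ, relEntropy_eq_iSup_skeleton hT hP hκ,
    fun s _ hst ↦ have := hκ.isMarkovKernel s; lintegral_relEntropy_rcpPast_eq_iSup hst.le (κ s)⟩
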